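/- Let $n\ge 1$ and let $M$ be a compact complex manifold with $C^\infty$ boundary, $\dim_{\mathbb C}M=n$; that is, $M$ is a compact (Hausdorff) smooth real $2n$-dimensional manifold with boundary, covered by open sets with coordinate maps into $\mathbb C^n$ that are diffeomorphisms onto their images (smooth up to the boundary) and whose transition maps are holomorphic in the interior. Write $M^{\mathrm{int}}$ for the interior, $\mathcal O(M^{\mathrm{int}})$ for the functions holomorphic in $M^{\mathrm{int}}$, and $\mathcal O(M)=C^\infty(M)\cap\mathcal O(M^{\mathrm{int}})$, where $C^k(M)$ and $C^\infty(M)$ denote complex valued functions of that regularity up to the boundary. Assume that (a) $M$ is holomorphically separable: for all $x\ne y$ in $M$ there is $f\in\mathcal O(M)$ with $f(x)\ne f(y)$; (b) $M$ has local charts given by global holomorphic functions: for every $p\in M$ there are $f_1,\dots,f_n\in\mathcal O(M)$ which form a complex coordinate system near $p$. Let $k\ge 2$ be an integer. Then there is a dense subset $S\subset M$ such that for every $p\in S$ there are functions $\Phi\in C^k(M)\cap\mathcal O(M^{\mathrm{int}})$ and $a\in\mathcal O(M)$ with the following properties: $d\Phi(p)=0$; $\operatorname{Im}\Phi$ is a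 Morse function in $M$ (its Hessian is nondegenerate at each of its critical points in $M$, boundary points included), so that it has finitely many critical points $p,p_1,\dots,p_N$ in $M$; $a(p)=1$ and $a(p_1)=\dots=a(p_N)=0$; and for every $h>0$ both functions $e^{\Phi/h}a$ and $e^{-\Phi/h}a$ belong to $C^k(M)\cap\mathcal O(M^{\mathrm{int}})$. In particular $\Phi$ and $a$ do not depend on $h$. -/

import Mathlib

open scoped Manifold ContDiff

noncomputable section

namespace ComplexBdry

/-- A smooth coordinate system on a smooth manifold with boundary `M` of real dimension `2 * n`, with
values in `ℂⁿ`: a diffeomorphism, smooth up to the boundary, of an open subset of `M` onto its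
image. The image `e.target` is open in `ℂⁿ` only where the domain avoids the boundary, and the
image of the boundary may be any smooth real hypersurface. -/
structure IsSmoothChart {n : ℕ} [NeZero n] {M : Type*} [TopologicalSpace M]
    [ChartedSpace (EuclideanHalfSpace (2 * n)) M]
    (e : PartialEquiv M (Fin n → ℂ)) : Prop where
  isOpen_source : IsOpen e.source
  contMDiffOn_toFun : ContMDiffOn (𝓡∂ (2 * n)) 𝓘(ℝ, Fin n → ℂ) ∞ e e.source
  contMDiffOn_symm : ContMDiffOn 𝓘(ℝ, Fin n → ℂ) (𝓡∂ (2 * n)) ∞ e.symm e.target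

/-- The transition map `e' ∘ e⁻¹` is holomorphic (on the image of the interior of `M`, which is an
open subset of `ℂⁿ` when `e` is a smooth chart). -/
def HolomorphicTransition {n : ℕ} [NeZero n] {M : Type*} [TopologicalSpace M]
    [ChartedSpace (EuclideanHalfSpace (2 * n)) M]
    (e e' : PartialEquiv M (Fin n → ℂ)) : Prop :=
  DifferentiableOn ℂ (e' ∘ e.symm)
    (e '' (e.source ∩ e'.source ∩ (𝓡∂ (2 * n)).interior M))

/-- A structure of `n`-dimensional complex manifold with smooth boundary on a smooth manifold with
boundary `M` of real dimension `2 * n`: a covering of `M` by smooth charts with values in `ℂⁿ`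
whose transition maps are holomorphic. -/
structure ComplexStructure (n : ℕ) [NeZero n] (M : Type*) [TopologicalSpace M]
    [ChartedSpace (EuclideanHalfSpace (2 * n)) M] where
  atlas : Set (PartialEquiv M (Fin n → ℂ))
  isSmoothChart : ∀ e ∈ atlas, IsSmoothChart e
  cover : ∀ x : M, ∃ e ∈ atlas, x ∈ e.source
  compatible : ∀ e ∈ atlas, ∀ e' ∈ atlas, HolomorphicTransition e e'

namespace ComplexStructure

variable {n : ℕ} [NeZero n] {M : Type*} [TopologicalSpace M]
  [ChartedSpace (EuclideanHalfSpace (2 * n)) M]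

/-- `e` is a complex coordinate system on an open subset of `M`: a smooth chart that is
holomorphically compatible with all the charts of the complex structure. -/
def IsComplexChart (X : ComplexStructure n M) (e : PartialEquiv M (Fin n → ℂ)) : Prop :=
  IsSmoothChart e ∧ ∀ e' ∈ X.atlas, HolomorphicTransition e e' ∧ HolomorphicTransition e' e

/-- `f` is holomorphic in the interior of `M`. -/
def HolomorphicInterior (X : ComplexStructure n M) (f : M → ℂ) : Prop :=
  ∀ e ∈ X.atlas, DifferentiableOn ℂ (f ∘ e.symm) (e '' (e.source ∩ (𝓡∂ (2 * n)).interior M))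

/-- The set `C^k(M) ∩ 𝒪(M^int)` of functions that are `C^k` up to the boundary and holomorphic in
the interior. -/
def holC (X : ComplexStructure n M) (k : WithTop ℕ∞) : Set (M → ℂ) :=
  {f | ContMDiff (𝓡∂ (2 * n)) 𝓘(ℝ, ℂ) k f ∧ X.HolomorphicInterior f}

/-- The set `𝒪(M)` of functions that are smooth up to the boundary and holomorphic in the
interior. -/
def hol (X : ComplexStructure n M) : Set (M → ℂ) := X.holC ∞

/-- Functions in `𝒪(M)` separate the points of `M`. -/
def HolomorphicallySeparable (X : ComplexStructure n M) : Prop :=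
  ∀ x y : M, x ≠ y → ∃ f ∈ X.hol, f x ≠ f y

/-- Near every point of `M`, boundary points included, some `f₁, …, fₙ ∈ 𝒪(M)` form a complex
coordinate system. -/
def HasGlobalHolomorphicCharts (X : ComplexStructure n M) : Prop :=
  ∀ p : M, ∃ f : Fin n → M → ℂ, (∀ j, f j ∈ X.hol) ∧
    ∃ e : PartialEquiv M (Fin n → ℂ), X.IsComplexChart e ∧ p ∈ e.source ∧
      ∀ x ∈ e.source, ∀ j, e x j = f j x

end ComplexStructure

section Morse

variable {n : ℕ} [NeZero n] {M : Type*} [TopologicalSpace M]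
  [ChartedSpace (EuclideanHalfSpace (2 * n)) M]

/-- `p` is a critical point of the real function `u`. -/
def IsCriticalPoint (u : M → ℝ) (p : M) : Prop :=
  mfderiv (𝓡∂ (2 * n)) 𝓘(ℝ, ℝ) u p = 0

/-- The matrix of second derivatives of `u` at `p`, as a bilinear form, in the preferred (real)
coordinates at `p`; at a boundary point the derivatives are one-sided. At a critical point it is
the Hessian of `u`, and its nondegeneracy does not depend on the coordinates. -/
def hessianAt (u : M → ℝ) (p : M) :
    EuclideanSpace ℝ (Fin (2 * n)) →L[ℝ] EuclideanSpace ℝ (Fin (2 * n)) →L[ℝ] ℝ :=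
  fderivWithin ℝ
    (fderivWithin ℝ (u ∘ (extChartAt (𝓡∂ (2 * n)) p).symm) (Set.range (𝓡∂ (2 * n))))
    (Set.range (𝓡∂ (2 * n))) (extChartAt (𝓡∂ (2 * n)) p p)

/-- `u` is a Morse function in `M`: it is `C²` and all its critical points in `M`, those on the
boundary included, are nondegenerate. -/
def IsMorse (u : M → ℝ) : Prop :=
  ContMDiff (𝓡∂ (2 * n)) 𝓘(ℝ, ℝ) 2 u ∧
    ∀ p : M, IsCriticalPoint (n := n) u p →
      ∀ v : EuclideanSpace ℝ (Fin (2 * n)), (∀ w, hessianAt (n := n) u p v w = 0) → v = 0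

end Morse

end ComplexBdry

end

/-! Every point `p` of `M` works, and `Φ` can be taken in `𝒪(M)`.

The argument rests on the complex gradient. If `G` consists of global holomorphic functions with
invertible differential near `q`, then `df = ∑ (∂f/∂G_j) dG_j` for every `f ∈ 𝒪(M)`: in the interior
because differentials are complex linear in the charts of `X`, and on the boundary by continuity
(`chartDeriv_eq_sum_grad`). Hence `Im f` is critical exactly where the gradient vanishes, and such a
point is nondegenerate exactly when the real derivative of the gradient is injective
(`morseAt_iff`). The Morse condition thus says that zero is a regular value of a map between spaces
of equal real dimension `2n`, boundary points included.

Replacing `f` by `f + ∑ a_j G_j` translates the gradient by `a`, so Sard's theorem makes it Morse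
near `q` for almost every `a` (`dense_morseAt_perturb`). Small perturbations preserve the Morse
condition on compact sets (`eventually_morseAt_perturb`).

To keep `p` critical, start from the sum of squares of coordinates centred at `p`, which is Morse
near `p`. Near `q ≠ p`, perturb by coordinates `h² g`, where `h` separates `q` from `p` and vanishes
at `p`; these have zero differential at `p` (`exists_coords_of_ne`). Finitely many perturbations
cover the compact manifold (`exists_morse`). Nondegenerate critical points are isolated, hence
finite in number, and `a` is a product of functions given by separability. -/

open scoped Topology

noncomputable section

namespace ComplexBdry

open Set Filter

/-! ### Derivatives in real charts, up to the boundary -/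

section Coordinates

variable {n : ℕ} [NeZero n] {M : Type*} [TopologicalSpace M]
  [ChartedSpace (EuclideanHalfSpace (2 * n)) M]
  {F : Type*} [NormedAddCommGroup F] [NormedSpace ℝ F]

/-- The derivative, in the preferred real chart at `q`, of a function on `M` with values in a normed
space. -/
def chartDeriv (q : M) (f : M → F) (z : EuclideanSpace ℝ (Fin (2 * n))) :
    EuclideanSpace ℝ (Fin (2 * n)) →L[ℝ] F :=
  fderivWithin ℝ (f ∘ (extChartAt (𝓡∂ (2 * n)) q).symm) (range (𝓡∂ (2 * n))) z

lemma extChartAt_mem_range {q x : M} (hx : x ∈ (extChartAt (𝓡∂ (2 * n)) q).source) :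
    extChartAt (𝓡∂ (2 * n)) q x ∈ range (𝓡∂ (2 * n)) :=
  extChartAt_target_subset_range q ((extChartAt (𝓡∂ (2 * n)) q).map_source hx)

/-- A property that holds near `x` in `M` holds near the image of `x` in the half space. -/
lemma eventually_extChartAt_symm {q x : M} (hx : x ∈ (extChartAt (𝓡∂ (2 * n)) q).source)
    {P : M → Prop} (hP : ∀ᶠ y in 𝓝 x, P y) :
    ∀ᶠ z in 𝓝[range (𝓡∂ (2 * n))] (extChartAt (𝓡∂ (2 * n)) q x),
      P ((extChartAt (𝓡∂ (2 * n)) q).symm z) := by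
  rw [← map_extChartAt_symm_nhdsWithin_range' hx] at hP
  exact hP

lemma eventually_mem_target {q x : M} (hx : x ∈ (extChartAt (𝓡∂ (2 * n)) q).source) :
    ∀ᶠ z in 𝓝[range (𝓡∂ (2 * n))] (extChartAt (𝓡∂ (2 * n)) q x),
      z ∈ (extChartAt (𝓡∂ (2 * n)) q).target :=
  extChartAt_target_mem_nhdsWithin' hx

lemma tendsto_extChartAt_nhdsWithin {q x : M} (hx : x ∈ (extChartAt (𝓡∂ (2 * n)) q).source) :
    Tendsto (extChartAt (𝓡∂ (2 * n)) q) (𝓝 x)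
      (𝓝[range (𝓡∂ (2 * n))] (extChartAt (𝓡∂ (2 * n)) q x)) := by
  refine tendsto_nhdsWithin_iff.2 ⟨(continuousAt_extChartAt' hx).tendsto, ?_⟩
  filter_upwards [extChartAt_source_mem_nhds' hx] with y hy using extChartAt_mem_range hy

lemma uniqueDiffWithinAt_chart {q x : M} (hx : x ∈ (extChartAt (𝓡∂ (2 * n)) q).source) :
    UniqueDiffWithinAt ℝ (range (𝓡∂ (2 * n))) (extChartAt (𝓡∂ (2 * n)) q x) :=
  (𝓡∂ (2 * n)).uniqueDiffOn _ (extChartAt_mem_range hx)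

lemma chartDeriv_eq {q x : M} (hx : x ∈ (extChartAt (𝓡∂ (2 * n)) q).source) {f : M → F}
    {L : EuclideanSpace ℝ (Fin (2 * n)) →L[ℝ] F}
    (h : HasFDerivWithinAt (f ∘ (extChartAt (𝓡∂ (2 * n)) q).symm) L (range (𝓡∂ (2 * n)))
      (extChartAt (𝓡∂ (2 * n)) q x)) :
    chartDeriv q f (extChartAt (𝓡∂ (2 * n)) q x) = L :=
  h.fderivWithin (uniqueDiffWithinAt_chart hx)

lemma mfderiv_eq_chartDeriv {x : M} {f : M → F}
    (hf : ContMDiffAt (𝓡∂ (2 * n)) 𝓘(ℝ, F) ∞ f x) :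
    mfderiv (𝓡∂ (2 * n)) 𝓘(ℝ, F) f x = chartDeriv x f (extChartAt (𝓡∂ (2 * n)) x x) := by
  rw [(hf.mdifferentiableAt (by simp)).mfderiv]
  rfl

variable [IsManifold (𝓡∂ (2 * n)) ∞ M]

lemma contDiffWithinAt_chart {q x : M} (hx : x ∈ (extChartAt (𝓡∂ (2 * n)) q).source)
    {f : M → F} (hf : ContMDiffAt (𝓡∂ (2 * n)) 𝓘(ℝ, F) ∞ f x) :
    ContDiffWithinAt ℝ ∞ (f ∘ (extChartAt (𝓡∂ (2 * n)) q).symm) (range (𝓡∂ (2 * n)))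
      (extChartAt (𝓡∂ (2 * n)) q x) := by
  have h := contMDiffWithinAt_extChartAt_symm_range (I := 𝓡∂ (2 * n)) (n := ∞) q
    ((extChartAt (𝓡∂ (2 * n)) q).map_source hx)
  rw [← contMDiffWithinAt_iff_contDiffWithinAt]
  refine ContMDiffAt.comp_contMDiffWithinAt _ ?_ h
  rwa [(extChartAt (𝓡∂ (2 * n)) q).left_inv hx]

lemma differentiableWithinAt_chart {q x : M} (hx : x ∈ (extChartAt (𝓡∂ (2 * n)) q).source)
    {f : M → F} (hf : ContMDiffAt (𝓡∂ (2 * n)) 𝓘(ℝ, F) ∞ f x) :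
    DifferentiableWithinAt ℝ (f ∘ (extChartAt (𝓡∂ (2 * n)) q).symm) (range (𝓡∂ (2 * n)))
      (extChartAt (𝓡∂ (2 * n)) q x) :=
  (contDiffWithinAt_chart hx hf).differentiableWithinAt (by simp)

lemma hasFDerivWithinAt_chart {q x : M} (hx : x ∈ (extChartAt (𝓡∂ (2 * n)) q).source)
    {f : M → F} (hf : ContMDiffAt (𝓡∂ (2 * n)) 𝓘(ℝ, F) ∞ f x) :
    HasFDerivWithinAt (f ∘ (extChartAt (𝓡∂ (2 * n)) q).symm)
      (chartDeriv q f (extChartAt (𝓡∂ (2 * n)) q x)) (range (𝓡∂ (2 * n)))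
      (extChartAt (𝓡∂ (2 * n)) q x) :=
  (differentiableWithinAt_chart hx hf).hasFDerivWithinAt

lemma contDiffWithinAt_chartDeriv {q x : M} (hx : x ∈ (extChartAt (𝓡∂ (2 * n)) q).source)
    {f : M → F} (hf : ContMDiffAt (𝓡∂ (2 * n)) 𝓘(ℝ, F) ∞ f x) :
    ContDiffWithinAt ℝ ∞ (chartDeriv (n := n) q f) (range (𝓡∂ (2 * n)))
      (extChartAt (𝓡∂ (2 * n)) q x) :=
  (contDiffWithinAt_chart hx hf).fderivWithin_right (𝓡∂ (2 * n)).uniqueDiffOn (by simp)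
    (extChartAt_mem_range hx)

/-- Change of chart for derivatives. -/
lemma chartDeriv_change {q y x : M} (hq : x ∈ (extChartAt (𝓡∂ (2 * n)) q).source)
    (hy : x ∈ (extChartAt (𝓡∂ (2 * n)) y).source)
    {f : M → F} (hf : ContMDiffAt (𝓡∂ (2 * n)) 𝓘(ℝ, F) ∞ f x) :
    chartDeriv y f (extChartAt (𝓡∂ (2 * n)) y x) =
      (chartDeriv q f (extChartAt (𝓡∂ (2 * n)) q x)).comp
        (tangentCoordChange (𝓡∂ (2 * n)) y q x) := by
  refine chartDeriv_eq hy ?_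
  have h1 := hasFDerivWithinAt_tangentCoordChange (I := 𝓡∂ (2 * n)) (x := y) (y := q) ⟨hy, hq⟩
  have h2 := hasFDerivWithinAt_chart hq hf
  set L := chartDeriv q f (extChartAt (𝓡∂ (2 * n)) q x)
  have e0 : (extChartAt (𝓡∂ (2 * n)) q ∘ (extChartAt (𝓡∂ (2 * n)) y).symm)
      (extChartAt (𝓡∂ (2 * n)) y x) = extChartAt (𝓡∂ (2 * n)) q x := by
    rw [Function.comp_apply, (extChartAt (𝓡∂ (2 * n)) y).left_inv hy]
  have hev := eventually_extChartAt_symm hy (extChartAt_source_mem_nhds' hq)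
  have hev' : ∀ᶠ w in 𝓝[range (𝓡∂ (2 * n))] (extChartAt (𝓡∂ (2 * n)) y x),
      (extChartAt (𝓡∂ (2 * n)) y).symm w ∈ (extChartAt (𝓡∂ (2 * n)) q).source := hev
  have h3 := HasFDerivWithinAt.comp_of_tendsto (extChartAt (𝓡∂ (2 * n)) y x) (e0 ▸ h2) h1 (by
    refine tendsto_nhdsWithin_iff.2 ⟨h1.continuousWithinAt, ?_⟩
    filter_upwards [hev'] with w hw using extChartAt_mem_range hw)
  refine h3.congr_of_eventuallyEq ?_ ?_
  · filter_upwards [hev'] with w hw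
    simp only [Function.comp_apply, (extChartAt (𝓡∂ (2 * n)) q).left_inv hw]
  · simp only [Function.comp_apply, (extChartAt (𝓡∂ (2 * n)) y).left_inv hy,
      (extChartAt (𝓡∂ (2 * n)) q).left_inv hq]

lemma tangentCoordChange_bijective {q y x : M} (hq : x ∈ (extChartAt (𝓡∂ (2 * n)) q).source)
    (hy : x ∈ (extChartAt (𝓡∂ (2 * n)) y).source) :
    Function.Bijective (tangentCoordChange (𝓡∂ (2 * n)) y q x) := by
  refine Function.bijective_iff_has_inverse.2 ⟨tangentCoordChange (𝓡∂ (2 * n)) q y x, ?_, ?_⟩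
  · intro v
    rw [tangentCoordChange_comp ⟨⟨hy, hq⟩, hy⟩, tangentCoordChange_self hy]
  · intro v
    rw [tangentCoordChange_comp ⟨⟨hq, hy⟩, hq⟩, tangentCoordChange_self hq]

end Coordinates

/-! ### Algebra of holomorphic functions -/

namespace ComplexStructure

variable {n : ℕ} [NeZero n] {M : Type*} [TopologicalSpace M]
  [ChartedSpace (EuclideanHalfSpace (2 * n)) M] (X : ComplexStructure n M)

variable {X} {k : WithTop ℕ∞} {f g : M → ℂ}

lemma holC_const (c : ℂ) : (fun _ => c) ∈ X.holC k :=
  ⟨contMDiff_const, fun _ _ => differentiableOn_const c⟩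

lemma holC_add (hf : f ∈ X.holC k) (hg : g ∈ X.holC k) : (fun x => f x + g x) ∈ X.holC k :=
  ⟨hf.1.add hg.1, fun e he => (hf.2 e he).add (hg.2 e he)⟩

lemma holC_mul (hf : f ∈ X.holC k) (hg : g ∈ X.holC k) : (fun x => f x * g x) ∈ X.holC k :=
  ⟨(contDiff_mul (𝕜 := ℝ) (𝔸 := ℂ)).comp_contMDiff (hf.1.prodMk_space hg.1),
    fun e he => (hf.2 e he).mul (hg.2 e he)⟩

lemma holC_sum {ι : Type*} (s : Finset ι) {f : ι → M → ℂ} (hf : ∀ i ∈ s, f i ∈ X.holC k) :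
    (fun x => ∑ i ∈ s, f i x) ∈ X.holC k := by
  classical
  induction s using Finset.induction_on with
  | empty => simpa using holC_const 0
  | insert i s hi ih =>
    simp only [Finset.sum_insert hi]
    exact holC_add (hf i (by simp)) (ih fun j hj => hf j (by simp [hj]))

lemma holC_prod {ι : Type*} (s : Finset ι) {f : ι → M → ℂ} (hf : ∀ i ∈ s, f i ∈ X.holC k) :
    (fun x => ∏ i ∈ s, f i x) ∈ X.holC k := by
  classical
  induction s using Finset.induction_on with
  | empty => simpa using holC_const 1
  | insert i s hi ih =>
    simp only [Finset.prod_insert hi]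
    exact holC_mul (hf i (by simp)) (ih fun j hj => hf j (by simp [hj]))

lemma holC_exp (hf : f ∈ X.holC k) : (fun x => Complex.exp (f x)) ∈ X.holC k :=
  ⟨((Complex.contDiff_exp (𝕜 := ℝ)).comp_contMDiff hf.1 : _), fun e he => (hf.2 e he).cexp⟩

lemma holC_sub_const (hf : f ∈ X.holC k) (c : ℂ) : (fun x => f x - c) ∈ X.holC k := by
  simpa [sub_eq_add_neg] using holC_add hf (holC_const (-c))

lemma hol_subset_holC (m : ℕ) : X.hol ⊆ X.holC m :=
  fun _ hf => ⟨hf.1.of_le (by exact_mod_cast le_top), hf.2⟩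

lemma contMDiff_of_forall_hol {G : M → Fin n → ℂ} (hG : ∀ j, (fun x => G x j) ∈ X.hol) :
    ContMDiff (𝓡∂ (2 * n)) 𝓘(ℝ, Fin n → ℂ) ∞ G :=
  contMDiff_pi_space.2 fun j => (hG j).1

end ComplexStructure

/-! ### The complex gradient in global holomorphic coordinates -/

section Gradient

lemma finrank_euclidean_eq (n : ℕ) :
    Module.finrank ℝ (EuclideanSpace ℝ (Fin (2 * n))) = Module.finrank ℝ (Fin n → ℂ) := by
  simp [Module.finrank_pi_fintype, Complex.finrank_real_complex, mul_comm]

/-- Both sides have real dimension `2n`. This makes `ContinuousLinearMap.inverse` in `grad` a true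
inverse on `coordSet`, rather than its default value zero. -/
lemma isInvertible_of_injective {n : ℕ}
    {L : EuclideanSpace ℝ (Fin (2 * n)) →L[ℝ] (Fin n → ℂ)} (hL : Function.Injective L) :
    L.IsInvertible := by
  let e := LinearEquiv.ofInjectiveOfFinrankEq (L : _ →ₗ[ℝ] (Fin n → ℂ)) hL (finrank_euclidean_eq n)
  exact ⟨e.toContinuousLinearEquiv, by ext; rfl⟩

variable {n : ℕ} [NeZero n] {M : Type*} [TopologicalSpace M]
  [ChartedSpace (EuclideanHalfSpace (2 * n)) M]

/-- The points of the preferred real chart at `q` at which the differential of `G` is injective. -/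
def coordSet (q : M) (G : M → Fin n → ℂ) : Set M :=
  {x | x ∈ (extChartAt (𝓡∂ (2 * n)) q).source ∧
    Function.Injective (chartDeriv q G (extChartAt (𝓡∂ (2 * n)) q x))}

/-- The vector of partial derivatives of `f` with respect to the complex coordinates `G`, as a
function on the preferred real chart at `q`. -/
def grad (q : M) (G : M → Fin n → ℂ) (f : M → ℂ) (z : EuclideanSpace ℝ (Fin (2 * n))) :
    Fin n → ℂ :=
  fun j => chartDeriv q f z ((chartDeriv q G z).inverse (Pi.single j 1))

variable [IsManifold (𝓡∂ (2 * n)) ∞ M] {X : ComplexStructure n M}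

/-- Injectivity is an open condition on linear maps in finite dimension, and the differential of `G`
is continuous up to the boundary. -/
lemma coordSet_mem_nhds {q x : M} {G : M → Fin n → ℂ}
    (hG : ContMDiff (𝓡∂ (2 * n)) 𝓘(ℝ, Fin n → ℂ) ∞ G) (hx : x ∈ coordSet q G) :
    coordSet q G ∈ 𝓝 x := by
  have h := ((contDiffWithinAt_chartDeriv hx.1 (hG x)).continuousWithinAt.tendsto.comp
    (tendsto_extChartAt_nhdsWithin hx.1)).eventually
    (ContinuousLinearMap.isOpen_injective.mem_nhds hx.2)
  filter_upwards [h, extChartAt_source_mem_nhds' hx.1] with y h1 h2 using ⟨h2, h1⟩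

lemma contDiffWithinAt_grad {q x : M} {G : M → Fin n → ℂ} {f : M → ℂ}
    (hG : ContMDiff (𝓡∂ (2 * n)) 𝓘(ℝ, Fin n → ℂ) ∞ G)
    (hf : ContMDiff (𝓡∂ (2 * n)) 𝓘(ℝ, ℂ) ∞ f) (hx : x ∈ coordSet q G) :
    ContDiffWithinAt ℝ ∞ (grad q G f) (range (𝓡∂ (2 * n))) (extChartAt (𝓡∂ (2 * n)) q x) := by
  refine contDiffWithinAt_pi.2 fun j => ?_
  refine (contDiffWithinAt_chartDeriv hx.1 (hf x)).clm_apply ?_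
  refine ContDiffWithinAt.clm_apply ?_ contDiffWithinAt_const
  exact (isInvertible_of_injective hx.2).contDiffAt_map_inverse.comp_contDiffWithinAt _
    (contDiffWithinAt_chartDeriv hx.1 (hG x))

lemma hasFDerivWithinAt_grad {q x : M} {G : M → Fin n → ℂ} {f : M → ℂ}
    (hG : ContMDiff (𝓡∂ (2 * n)) 𝓘(ℝ, Fin n → ℂ) ∞ G)
    (hf : ContMDiff (𝓡∂ (2 * n)) 𝓘(ℝ, ℂ) ∞ f) (hx : x ∈ coordSet q G) :
    HasFDerivWithinAt (grad q G f)
      (fderivWithin ℝ (grad q G f) (range (𝓡∂ (2 * n))) (extChartAt (𝓡∂ (2 * n)) q x))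
      (range (𝓡∂ (2 * n))) (extChartAt (𝓡∂ (2 * n)) q x) :=
  ((contDiffWithinAt_grad hG hf hx).differentiableWithinAt (by simp)).hasFDerivWithinAt

/-- At interior points the differential of a holomorphic function is the complex linear combination
of the differentials of the coordinates. -/
lemma chartDeriv_eq_sum_grad_of_interior {q x : M} {G : M → Fin n → ℂ} {f : M → ℂ}
    (hG : ∀ j, (fun x => G x j) ∈ X.hol) (hf : f ∈ X.hol) (hx : x ∈ coordSet q G)
    (hint : x ∈ (𝓡∂ (2 * n)).interior M) (v : EuclideanSpace ℝ (Fin (2 * n))) :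
    chartDeriv q f (extChartAt (𝓡∂ (2 * n)) q x) v =
      ∑ j, grad q G f (extChartAt (𝓡∂ (2 * n)) q x) j *
        chartDeriv q G (extChartAt (𝓡∂ (2 * n)) q x) v j := by
  obtain ⟨e, he, hxe⟩ := X.cover x
  have hes := X.isSmoothChart e he
  set s := e '' (e.source ∩ (𝓡∂ (2 * n)).interior M) with hs
  set z := extChartAt (𝓡∂ (2 * n)) q x with hz
  have hxs : e x ∈ s := ⟨x, ⟨hxe, hint⟩, rfl⟩
  have hxz : (extChartAt (𝓡∂ (2 * n)) q).symm z = x := (extChartAt (𝓡∂ (2 * n)) q).left_inv hx.1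
  have hopen : ∀ᶠ w in 𝓝[range (𝓡∂ (2 * n))] z,
      (extChartAt (𝓡∂ (2 * n)) q).symm w ∈ e.source ∩ (𝓡∂ (2 * n)).interior M :=
    eventually_extChartAt_symm hx.1 ((hes.isOpen_source.inter
      ((𝓡∂ (2 * n)).isOpen_interior (n := ∞) (by simp))).mem_nhds ⟨hxe, hint⟩)
  have hesm : ContMDiffAt (𝓡∂ (2 * n)) 𝓘(ℝ, Fin n → ℂ) ∞ e x :=
    hes.contMDiffOn_toFun.contMDiffAt (hes.isOpen_source.mem_nhds hxe)
  have hde := hasFDerivWithinAt_chart hx.1 hesm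
  -- Chain rule through the holomorphic chart `e`: the differential of a holomorphic map is a
  -- complex linear map after that of `e`.
  have key : ∀ {F : Type} [NormedAddCommGroup F] [NormedSpace ℂ F] (u : M → F),
      DifferentiableWithinAt ℂ (u ∘ e.symm) s (e x) →
      ∃ L : (Fin n → ℂ) →L[ℂ] F,
        chartDeriv q u z = (L.restrictScalars ℝ).comp (chartDeriv q e z) := by
    intro F _ _ u hu
    refine ⟨fderivWithin ℂ (u ∘ e.symm) s (e x), chartDeriv_eq hx.1 ?_⟩
    have h1 := hu.hasFDerivWithinAt.restrictScalars ℝ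
    have h1' : HasFDerivWithinAt (u ∘ e.symm)
        ((fderivWithin ℂ (u ∘ e.symm) s (e x)).restrictScalars ℝ) s
        ((e ∘ (extChartAt (𝓡∂ (2 * n)) q).symm) z) := by
      rwa [Function.comp_apply, hxz]
    have h2 := HasFDerivWithinAt.comp_of_tendsto z h1' hde (by
      refine tendsto_nhdsWithin_iff.2 ⟨hde.continuousWithinAt, ?_⟩
      filter_upwards [hopen] with w hw using ⟨_, hw, rfl⟩)
    refine h2.congr_of_eventuallyEq ?_ ?_
    · filter_upwards [hopen] with w hw
      simp only [Function.comp_apply, e.left_inv hw.1]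
    · simp only [Function.comp_apply, hxz, e.left_inv hxe]
  obtain ⟨A, hA⟩ := key f (hf.2 e he _ hxs)
  obtain ⟨B, hB⟩ := key G (differentiableWithinAt_pi.2 fun j => (hG j).2 e he _ hxs)
  obtain ⟨N, hN⟩ := isInvertible_of_injective hx.2
  have hNB : ∀ w, B (chartDeriv q e z w) = N w := fun w => by
    have := congrArg (fun L => L w) (hN.trans hB)
    exact this.symm
  have hBsurj : Function.Surjective B := fun c => ⟨chartDeriv q e z (N.symm c), by
    rw [hNB, N.apply_symm_apply]⟩
  -- `B` is the complex derivative of `G` in the chart `e`. As it is injective, the expansion of `dG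
  -- v` in the standard basis of `ℂⁿ` lifts to one of `de v`, to which `A` then applies.
  have hBinj : Function.Injective B :=
    (LinearMap.injective_iff_surjective (f := (B : (Fin n → ℂ) →ₗ[ℂ] (Fin n → ℂ)))).2 hBsurj
  have hinv : ∀ c, (chartDeriv q G z).inverse c = N.symm c := fun c => by
    rw [← hz] at hN
    rw [← hN, ContinuousLinearMap.inverse_equiv]; rfl
  have hGN : ∀ w, chartDeriv q G z w = N w := fun w => by rw [hB]; exact hNB w
  have hdecomp : chartDeriv q e z v =
      ∑ j, (N v j) • chartDeriv q e z (N.symm (Pi.single j 1)) := by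
    apply hBinj
    rw [hNB, map_sum]
    simp only [map_smul, hNB, N.apply_symm_apply]
    ext i
    simp [Finset.sum_apply, Pi.single_apply]
  have hfv : chartDeriv q f z v = A (chartDeriv q e z v) := by rw [hA]; rfl
  rw [hfv, hdecomp, map_sum]
  refine Finset.sum_congr rfl fun j _ => ?_
  rw [map_smul, smul_eq_mul, mul_comm, hGN, grad, hinv, hA]
  rfl

/-- The differential of a function in `𝒪(M)` is the complex linear combination of the differentials
of the coordinates, up to the boundary. -/
lemma chartDeriv_eq_sum_grad {q x : M} {G : M → Fin n → ℂ} {f : M → ℂ}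
    (hG : ∀ j, (fun x => G x j) ∈ X.hol) (hf : f ∈ X.hol) (hx : x ∈ coordSet q G)
    (v : EuclideanSpace ℝ (Fin (2 * n))) :
    chartDeriv q f (extChartAt (𝓡∂ (2 * n)) q x) v =
      ∑ j, grad q G f (extChartAt (𝓡∂ (2 * n)) q x) j *
        chartDeriv q G (extChartAt (𝓡∂ (2 * n)) q x) v j := by
  have hGs := ComplexStructure.contMDiff_of_forall_hol hG
  set z := extChartAt (𝓡∂ (2 * n)) q x with hz
  set R := range (𝓡∂ (2 * n))
  -- The half space is the closure of its interior, so an identity between continuous functions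
  -- passes from interior points to the boundary.
  have hne : (𝓝[interior R] z).NeBot := by
    rw [← mem_closure_iff_nhdsWithin_neBot,
      (𝓡∂ (2 * n)).convex_range.closure_interior_eq_closure_of_nonempty_interior
        (𝓡∂ (2 * n)).nonempty_interior]
    exact subset_closure (extChartAt_mem_range hx.1)
  have hle : 𝓝[interior R] z ≤ 𝓝[R] z := nhdsWithin_mono _ interior_subset
  have h1 : Tendsto (fun w => chartDeriv q f w v) (𝓝[interior R] z)
      (𝓝 (chartDeriv q f z v)) :=
    (((contDiffWithinAt_chartDeriv hx.1 (hf.1 x)).continuousWithinAt.clm_apply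
      continuousWithinAt_const).tendsto).mono_left hle
  have h2 : Tendsto (fun w => ∑ j, grad q G f w j * chartDeriv q G w v j) (𝓝[interior R] z)
      (𝓝 (∑ j, grad q G f z j * chartDeriv q G z v j)) := by
    refine tendsto_finsetSum _ fun j _ => Tendsto.mul ?_ ?_
    · exact ((continuousWithinAt_pi.1
        (contDiffWithinAt_grad hGs hf.1 hx).continuousWithinAt j).tendsto).mono_left hle
    · exact ((continuousWithinAt_pi.1 ((contDiffWithinAt_chartDeriv hx.1
        (hGs x)).continuousWithinAt.clm_apply continuousWithinAt_const) j).tendsto).mono_left hle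
  refine tendsto_nhds_unique_of_eventuallyEq h1 h2 ?_
  filter_upwards [hle (eventually_mem_target hx.1),
    hle (eventually_extChartAt_symm hx.1 (coordSet_mem_nhds hGs hx)),
    self_mem_nhdsWithin] with w hw1 hw2 hw3
  have hw4 : (extChartAt (𝓡∂ (2 * n)) q).symm w ∈ (𝓡∂ (2 * n)).interior M := by
    have := (𝓡∂ (2 * n)).isInteriorPoint_iff_of_mem_atlas (n := ∞)
      (x := (extChartAt (𝓡∂ (2 * n)) q).symm w) (by simp)
      (chart_mem_atlas (EuclideanHalfSpace (2 * n)) q) (by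
        rw [← extChartAt_source (𝓡∂ (2 * n))]
        exact (extChartAt (𝓡∂ (2 * n)) q).map_target hw1)
    refine this.2 ?_
    change extChartAt (𝓡∂ (2 * n)) q _ ∈ _
    rw [(extChartAt (𝓡∂ (2 * n)) q).right_inv hw1]
    have hI : (𝓡∂ (2 * n)) ((𝓡∂ (2 * n)).symm w) = w :=
      (𝓡∂ (2 * n)).right_inv (interior_subset hw3)
    have h3 := (chartAt (EuclideanHalfSpace (2 * n)) q).mem_interior_extend_target
      (I := 𝓡∂ (2 * n)) ((extChartAt_target (𝓡∂ (2 * n)) q ▸ hw1).1) (by rwa [hI])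
    rwa [hI] at h3
  have := chartDeriv_eq_sum_grad_of_interior hG hf hw2 hw4 v
  rwa [(extChartAt (𝓡∂ (2 * n)) q).right_inv hw1] at this

end Gradient

/-! ### Critical points and Hessians through the complex gradient -/

section Morse

/-- Testing on `e_j` and `i e_j` recovers the imaginary and real parts of `b_j`. This is why the
imaginary part alone determines the complex differential. -/
lemma eq_zero_of_forall_im_sum_mul {n : ℕ} {b : Fin n → ℂ}
    (h : ∀ c : Fin n → ℂ, (∑ j, b j * c j).im = 0) : b = 0 := by
  ext j
  have h1 := h (Pi.single j 1)
  have h2 := h (Pi.single j Complex.I)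
  simp [Pi.single_apply] at h1 h2
  exact Complex.ext h2 h1

variable {n : ℕ} [NeZero n] {M : Type*} [TopologicalSpace M]
  [ChartedSpace (EuclideanHalfSpace (2 * n)) M]

/-- `p` is not a degenerate critical point of the imaginary part of `f`. -/
def MorseAt (f : M → ℂ) (p : M) : Prop :=
  IsCriticalPoint (n := n) (fun x => (f x).im) p →
    ∀ v : EuclideanSpace ℝ (Fin (2 * n)),
      (∀ w, hessianAt (n := n) (fun x => (f x).im) p v w = 0) → v = 0

lemma contMDiff_im {f : M → ℂ} {k : WithTop ℕ∞} (hf : ContMDiff (𝓡∂ (2 * n)) 𝓘(ℝ, ℂ) k f) :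
    ContMDiff (𝓡∂ (2 * n)) 𝓘(ℝ, ℝ) k (fun x => (f x).im) :=
  Complex.imCLM.contDiff.comp_contMDiff hf

variable [IsManifold (𝓡∂ (2 * n)) ∞ M] {X : ComplexStructure n M}

lemma chartDeriv_im {q x : M} {f : M → ℂ} (hf : ContMDiff (𝓡∂ (2 * n)) 𝓘(ℝ, ℂ) ∞ f)
    (hx : x ∈ (extChartAt (𝓡∂ (2 * n)) q).source) :
    chartDeriv q (fun x => (f x).im) (extChartAt (𝓡∂ (2 * n)) q x) =
      Complex.imCLM.comp (chartDeriv q f (extChartAt (𝓡∂ (2 * n)) q x)) :=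
  chartDeriv_eq hx (Complex.imCLM.hasFDerivAt.comp_hasFDerivWithinAt _
    (hasFDerivWithinAt_chart hx (hf x)))

lemma chartDeriv_apply {q x : M} {G : M → Fin n → ℂ}
    (hG : ContMDiff (𝓡∂ (2 * n)) 𝓘(ℝ, Fin n → ℂ) ∞ G)
    (hx : x ∈ (extChartAt (𝓡∂ (2 * n)) q).source) (j : Fin n)
    (v : EuclideanSpace ℝ (Fin (2 * n))) :
    chartDeriv q (fun x => G x j) (extChartAt (𝓡∂ (2 * n)) q x) v =
      chartDeriv q G (extChartAt (𝓡∂ (2 * n)) q x) v j := by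
  rw [chartDeriv_eq hx (f := fun x => G x j)
    (hasFDerivWithinAt_pi'.1 (hasFDerivWithinAt_chart hx (hG x)) j)]
  rfl

/-- The differential in the preferred chart at `y`, expressed by the gradient with respect to
coordinates near `q`. -/
lemma chartDeriv_eq_sum_grad_smul {q y x : M} {G : M → Fin n → ℂ} {f : M → ℂ}
    (hG : ∀ j, (fun x => G x j) ∈ X.hol) (hf : f ∈ X.hol) (hx : x ∈ coordSet q G)
    (hy : x ∈ (extChartAt (𝓡∂ (2 * n)) y).source) :
    chartDeriv y f (extChartAt (𝓡∂ (2 * n)) y x) =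
      ∑ j, grad q G f (extChartAt (𝓡∂ (2 * n)) q x) j •
        chartDeriv y (fun x => G x j) (extChartAt (𝓡∂ (2 * n)) y x) := by
  have hGs := ComplexStructure.contMDiff_of_forall_hol hG
  ext v
  rw [chartDeriv_change hx.1 hy (hf.1 x), ContinuousLinearMap.comp_apply,
    chartDeriv_eq_sum_grad hG hf hx, _root_.sum_apply]
  refine Finset.sum_congr rfl fun j _ => ?_
  rw [_root_.smul_apply, chartDeriv_change hx.1 hy ((hG j).1 x),
    ContinuousLinearMap.comp_apply, chartDeriv_apply hGs hx.1, smul_eq_mul]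

lemma chartDeriv_surjective_of_mem_coordSet {q y : M} {G : M → Fin n → ℂ}
    (hG : ContMDiff (𝓡∂ (2 * n)) 𝓘(ℝ, Fin n → ℂ) ∞ G) (hy : y ∈ coordSet q G) :
    Function.Surjective (chartDeriv y G (extChartAt (𝓡∂ (2 * n)) y y)) := by
  rw [chartDeriv_change hy.1 (mem_extChartAt_source y) (hG y)]
  obtain ⟨N, hN⟩ := isInvertible_of_injective hy.2
  rw [← hN]
  exact N.surjective.comp (tangentCoordChange_bijective hy.1 (mem_extChartAt_source y)).surjective

/-- The differential of `G` takes every value in `ℂⁿ`, so `Im ∑ (∂f/∂G_j) dG_j = 0` forces each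
coefficient to vanish. -/
lemma isCriticalPoint_iff_grad_eq_zero {q y : M} {G : M → Fin n → ℂ} {f : M → ℂ}
    (hG : ∀ j, (fun x => G x j) ∈ X.hol) (hf : f ∈ X.hol) (hy : y ∈ coordSet q G) :
    IsCriticalPoint (n := n) (fun x => (f x).im) y ↔
      grad q G f (extChartAt (𝓡∂ (2 * n)) q y) = 0 := by
  have hGs := ComplexStructure.contMDiff_of_forall_hol hG
  have hyy := mem_extChartAt_source (I := 𝓡∂ (2 * n)) y
  have h0 : IsCriticalPoint (n := n) (fun x => (f x).im) y ↔
      chartDeriv y (fun x => (f x).im) (extChartAt (𝓡∂ (2 * n)) y y) = 0 := by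
    rw [IsCriticalPoint, mfderiv_eq_chartDeriv (contMDiff_im hf.1 y)]
    rfl
  rw [h0, chartDeriv_im hf.1 hyy, chartDeriv_eq_sum_grad_smul hG hf hy hyy]
  constructor
  · intro h
    refine eq_zero_of_forall_im_sum_mul fun c => ?_
    obtain ⟨w, rfl⟩ := chartDeriv_surjective_of_mem_coordSet hGs hy c
    have h1 := congrArg (fun L => L w) h
    simpa only [ContinuousLinearMap.comp_apply, _root_.sum_apply, _root_.smul_apply, smul_eq_mul,
      chartDeriv_apply hGs hyy, Complex.imCLM_apply, _root_.zero_apply] using h1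
  · intro h
    simp only [h, Pi.zero_apply, zero_smul, Finset.sum_const_zero, ContinuousLinearMap.comp_zero]

/-- Differentiating `∑ (∂f/∂G_j) dG_j` by the product rule, the terms with second derivatives of `G`
carry a factor of the gradient and drop out. The coordinate change appears because the Hessian is
taken in the chart at `y` and the gradient in the chart at `q`. -/
lemma hessianAt_eq_of_grad_eq_zero {q y : M} {G : M → Fin n → ℂ} {f : M → ℂ}
    (hG : ∀ j, (fun x => G x j) ∈ X.hol) (hf : f ∈ X.hol) (hy : y ∈ coordSet q G)
    (h0 : grad q G f (extChartAt (𝓡∂ (2 * n)) q y) = 0)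
    (v w : EuclideanSpace ℝ (Fin (2 * n))) :
    hessianAt (n := n) (fun x => (f x).im) y v w =
      (∑ j, fderivWithin ℝ (grad q G f) (range (𝓡∂ (2 * n))) (extChartAt (𝓡∂ (2 * n)) q y)
        (tangentCoordChange (𝓡∂ (2 * n)) y q y v) j *
          chartDeriv y G (extChartAt (𝓡∂ (2 * n)) y y) w j).im := by
  have hGs := ComplexStructure.contMDiff_of_forall_hol hG
  have hyy := mem_extChartAt_source (I := 𝓡∂ (2 * n)) y
  set R := range (𝓡∂ (2 * n))
  set z := extChartAt (𝓡∂ (2 * n)) y y with hz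
  have hzy : (extChartAt (𝓡∂ (2 * n)) y).symm z = y := (extChartAt (𝓡∂ (2 * n)) y).left_inv hyy
  set τ := extChartAt (𝓡∂ (2 * n)) q ∘ (extChartAt (𝓡∂ (2 * n)) y).symm with hτ
  have hτz : τ z = extChartAt (𝓡∂ (2 * n)) q y := by rw [hτ, Function.comp_apply, hzy]
  have hev : ∀ᶠ u in 𝓝[R] z, (extChartAt (𝓡∂ (2 * n)) y).symm u ∈ coordSet q G :=
    eventually_extChartAt_symm hyy (coordSet_mem_nhds hGs hy)
  have hdτ : HasFDerivWithinAt τ (tangentCoordChange (𝓡∂ (2 * n)) y q y) R z :=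
    hasFDerivWithinAt_tangentCoordChange ⟨hyy, hy.1⟩
  have hB := HasFDerivWithinAt.comp_of_tendsto z (hτz ▸ hasFDerivWithinAt_grad hGs hf.1 hy) hdτ (by
    refine tendsto_nhdsWithin_iff.2 ⟨hdτ.continuousWithinAt, ?_⟩
    filter_upwards [hev] with u hu using extChartAt_mem_range hu.1)
  rw [hτz] at hB
  have hD : ∀ j, HasFDerivWithinAt (chartDeriv (n := n) y fun x => G x j) _ R z := fun j =>
    ((contDiffWithinAt_chartDeriv hyy ((hG j).1 y)).differentiableWithinAt
      (by simp)).hasFDerivWithinAt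
  have hS := HasFDerivWithinAt.fun_sum (u := Finset.univ) fun j _ =>
    ((hasFDerivWithinAt_pi'.1 hB j).smul (hD j))
  have hS2 := ((ContinuousLinearMap.compL ℝ (EuclideanSpace ℝ (Fin (2 * n))) ℂ ℝ
    Complex.imCLM).hasFDerivAt).comp_hasFDerivWithinAt z hS
  have heq : fderivWithin ℝ ((fun x => (f x).im) ∘ (extChartAt (𝓡∂ (2 * n)) y).symm) R =ᶠ[𝓝[R] z]
      (ContinuousLinearMap.compL ℝ (EuclideanSpace ℝ (Fin (2 * n))) ℂ ℝ Complex.imCLM) ∘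
      fun u => ∑ j, ((grad q G f ∘ τ) u j) • chartDeriv y (fun x => G x j) u := by
    filter_upwards [hev, eventually_mem_target hyy] with u hu hut
    have hus := (extChartAt (𝓡∂ (2 * n)) y).map_target hut
    have h1 := chartDeriv_im hf.1 hus
    rw [chartDeriv_eq_sum_grad_smul hG hf hu hus, (extChartAt (𝓡∂ (2 * n)) y).right_inv hut] at h1
    exact h1
  have hfin := (hS2.congr_of_eventuallyEq heq
    (heq.eq_of_nhdsWithin (extChartAt_mem_range hyy))).fderivWithin (uniqueDiffWithinAt_chart hyy)
  have hfin2 : hessianAt (n := n) (fun x => (f x).im) y = _ := hfin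
  have hap : ∀ j, chartDeriv y (fun x => G x j) z w = chartDeriv y G z w j :=
    fun j => chartDeriv_apply hGs hyy j w
  rw [hfin2]
  simp only [Function.comp_apply, hτz, h0, Pi.zero_apply, zero_smul, zero_add,
    ContinuousLinearMap.comp_apply, _root_.sum_apply, ContinuousLinearMap.compL_apply,
    ContinuousLinearMap.smulRight_apply, _root_.smul_apply, smul_eq_mul, Complex.imCLM_apply,
    ContinuousLinearMap.proj_apply, hap]
  rfl

/-- Nondegeneracy of the critical points of `Im f` expressed by the complex gradient. -/
lemma morseAt_iff {q y : M} {G : M → Fin n → ℂ} {f : M → ℂ}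
    (hG : ∀ j, (fun x => G x j) ∈ X.hol) (hf : f ∈ X.hol) (hy : y ∈ coordSet q G) :
    MorseAt (n := n) f y ↔ (grad q G f (extChartAt (𝓡∂ (2 * n)) q y) = 0 →
      Function.Injective (fderivWithin ℝ (grad q G f) (range (𝓡∂ (2 * n)))
        (extChartAt (𝓡∂ (2 * n)) q y))) := by
  have hGs := ComplexStructure.contMDiff_of_forall_hol hG
  have hT := tangentCoordChange_bijective hy.1 (mem_extChartAt_source y)
  rw [MorseAt, isCriticalPoint_iff_grad_eq_zero hG hf hy]
  refine forall_congr' fun h0 => ?_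
  simp only [hessianAt_eq_of_grad_eq_zero hG hf hy h0]
  rw [injective_iff_map_eq_zero]
  constructor
  · intro h a ha
    obtain ⟨v, rfl⟩ := hT.surjective a
    rw [h v fun w => by simp only [ha, Pi.zero_apply, zero_mul, Finset.sum_const_zero,
      Complex.zero_im], map_zero]
  · intro h v hv
    have : tangentCoordChange (𝓡∂ (2 * n)) y q y v = 0 := by
      refine h _ (eq_zero_of_forall_im_sum_mul fun c => ?_)
      obtain ⟨w, rfl⟩ := chartDeriv_surjective_of_mem_coordSet hGs hy c
      exact hv w
    exact hT.injective (by rw [this, map_zero])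

end Morse

/-! ### Perturbation: stability, isolation of critical points, Sard's theorem -/

section Perturbation

/-- The perturbation of `f` by a linear combination of the components of `F`. -/
def perturb {n : ℕ} {M : Type*} (f : M → ℂ) (F : M → Fin n → ℂ) (a : Fin n → ℂ) : M → ℂ :=
  fun x => f x + ∑ j, a j * F x j

lemma perturb_zero {n : ℕ} {M : Type*} (f : M → ℂ) (F : M → Fin n → ℂ) : perturb f F 0 = f := by
  ext x
  simp [perturb]

variable {n : ℕ} [NeZero n] {M : Type*} [TopologicalSpace M]
  [ChartedSpace (EuclideanHalfSpace (2 * n)) M]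

/-- A smooth chart has injective differential. -/
lemma IsSmoothChart.mfderiv_injective {e : PartialEquiv M (Fin n → ℂ)} (he : IsSmoothChart e)
    {q : M} (hq : q ∈ e.source) :
    Function.Injective (mfderiv (𝓡∂ (2 * n)) 𝓘(ℝ, Fin n → ℂ) e q) := by
  have h1 := ((he.contMDiffOn_symm _ (e.map_source hq)).mdifferentiableWithinAt
    (by simp)).hasMFDerivWithinAt
  have h2 := ((he.contMDiffOn_toFun.contMDiffAt (he.isOpen_source.mem_nhds hq)).mdifferentiableAt
    (by simp)).hasMFDerivAt.hasMFDerivWithinAt (s := e.source)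
  have h3 := h1.comp q h2 fun x hx => e.map_source hx
  have h4 : HasMFDerivWithinAt (𝓡∂ (2 * n)) (𝓡∂ (2 * n)) (e.symm ∘ e) e.source q
      (ContinuousLinearMap.id ℝ (TangentSpace (𝓡∂ (2 * n)) q)) :=
    (hasMFDerivWithinAt_id e.source q).congr_of_eventuallyEq
      -- Uniqueness of derivatives is invoked only within `e.source`, which is open in `M`;
      -- `e.target` need not be open in `ℂⁿ`.
      (eventually_nhdsWithin_of_forall fun x hx => e.left_inv hx) (e.left_inv hq)
  have h5 := (he.isOpen_source.uniqueMDiffWithinAt (I := 𝓡∂ (2 * n)) hq).eq h3 h4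
  intro v w hvw
  have h8 : ∀ u, (mfderivWithin 𝓘(ℝ, Fin n → ℂ) (𝓡∂ (2 * n)) e.symm e.target (e q))
    (mfderiv (𝓡∂ (2 * n)) 𝓘(ℝ, Fin n → ℂ) e q u) = u := fun u => congrArg (fun L => L u) h5
  rw [← h8 v, hvw, h8 w]

lemma perturb_mem_hol {X : ComplexStructure n M} {f : M → ℂ} {F : M → Fin n → ℂ} (hf : f ∈ X.hol)
    (hF : ∀ j, (fun x => F x j) ∈ X.hol) (a : Fin n → ℂ) : perturb f F a ∈ X.hol :=
  ComplexStructure.holC_add hf (ComplexStructure.holC_sum _ fun j _ =>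
    ComplexStructure.holC_mul (ComplexStructure.holC_const (a j)) (hF j))

variable [IsManifold (𝓡∂ (2 * n)) ∞ M] {X : ComplexStructure n M}

/-- Near every point there are global holomorphic coordinates, vanishing at that point. -/
lemma ComplexStructure.HasGlobalHolomorphicCharts.exists_coords
    (hcharts : X.HasGlobalHolomorphicCharts) (q : M) :
    ∃ G : M → Fin n → ℂ, (∀ j, (fun x => G x j) ∈ X.hol) ∧ G q = 0 ∧ q ∈ coordSet q G := by
  obtain ⟨f, hf, e, he, hq, hfe⟩ := hcharts q
  have hGhol : ∀ j, (fun x => f j x - f j q) ∈ X.hol :=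
    fun j => ComplexStructure.holC_sub_const (hf j) _
  refine ⟨fun x j => f j x - f j q, hGhol, by ext; simp, mem_extChartAt_source q, ?_⟩
  have hG : ContMDiff (𝓡∂ (2 * n)) 𝓘(ℝ, Fin n → ℂ) ∞ (fun x j => f j x - f j q) :=
    ComplexStructure.contMDiff_of_forall_hol hGhol
  have hesm := he.1.contMDiffOn_toFun.contMDiffAt (he.1.isOpen_source.mem_nhds hq)
  have hde := hasFDerivWithinAt_chart (mem_extChartAt_source q) hesm
  have hqz := (extChartAt (𝓡∂ (2 * n)) q).left_inv (mem_extChartAt_source q)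
  have heq : chartDeriv q (fun x j => f j x - f j q) (extChartAt (𝓡∂ (2 * n)) q q) =
      chartDeriv q e (extChartAt (𝓡∂ (2 * n)) q q) := by
    refine chartDeriv_eq (mem_extChartAt_source q)
      ((hde.sub_const (fun j => f j q)).congr_of_eventuallyEq ?_ ?_)
    · filter_upwards [eventually_extChartAt_symm (mem_extChartAt_source q)
        (he.1.isOpen_source.mem_nhds hq)] with w hw
      ext j
      simp only [Function.comp_apply, Pi.sub_apply, hfe _ hw]
    · ext j
      simp only [Function.comp_apply, Pi.sub_apply, hqz, hfe _ hq]
  rw [heq, ← mfderiv_eq_chartDeriv hesm]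
  exact he.1.mfderiv_injective hq

lemma chartDeriv_perturb {q x : M} {f : M → ℂ} {F : M → Fin n → ℂ} (hf : f ∈ X.hol)
    (hF : ∀ j, (fun x => F x j) ∈ X.hol) (a : Fin n → ℂ)
    (hx : x ∈ (extChartAt (𝓡∂ (2 * n)) q).source) :
    chartDeriv q (perturb f F a) (extChartAt (𝓡∂ (2 * n)) q x) =
      chartDeriv q f (extChartAt (𝓡∂ (2 * n)) q x) +
        ∑ j, a j • chartDeriv q (fun x => F x j) (extChartAt (𝓡∂ (2 * n)) q x) :=
  chartDeriv_eq hx ((hasFDerivWithinAt_chart hx (hf.1 x)).add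
    (HasFDerivWithinAt.fun_sum fun j _ =>
      (hasFDerivWithinAt_chart hx ((hF j).1 x)).const_smul (a j)))

lemma grad_perturb {q x : M} {f : M → ℂ} {F G : M → Fin n → ℂ} (hf : f ∈ X.hol)
    (hF : ∀ j, (fun x => F x j) ∈ X.hol) (a : Fin n → ℂ)
    (hx : x ∈ (extChartAt (𝓡∂ (2 * n)) q).source) :
    grad q G (perturb f F a) (extChartAt (𝓡∂ (2 * n)) q x) =
      grad q G f (extChartAt (𝓡∂ (2 * n)) q x) +
        ∑ j, a j • grad q G (fun x => F x j) (extChartAt (𝓡∂ (2 * n)) q x) := by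
  ext i
  simp only [grad, chartDeriv_perturb hf hF a hx, _root_.add_apply, _root_.sum_apply,
    _root_.smul_apply, Pi.add_apply, Finset.sum_apply, Pi.smul_apply]

lemma fderivWithin_grad_perturb {q x : M} {f : M → ℂ} {F G : M → Fin n → ℂ}
    (hG : ContMDiff (𝓡∂ (2 * n)) 𝓘(ℝ, Fin n → ℂ) ∞ G) (hf : f ∈ X.hol)
    (hF : ∀ j, (fun x => F x j) ∈ X.hol) (a : Fin n → ℂ) (hx : x ∈ coordSet q G) :
    fderivWithin ℝ (grad q G (perturb f F a)) (range (𝓡∂ (2 * n)))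
        (extChartAt (𝓡∂ (2 * n)) q x) =
      fderivWithin ℝ (grad q G f) (range (𝓡∂ (2 * n))) (extChartAt (𝓡∂ (2 * n)) q x) +
        ∑ j, a j • fderivWithin ℝ (grad q G (fun x => F x j)) (range (𝓡∂ (2 * n)))
          (extChartAt (𝓡∂ (2 * n)) q x) := by
  have h := (hasFDerivWithinAt_grad hG hf.1 hx).add (HasFDerivWithinAt.fun_sum
    (u := Finset.univ) fun j _ => (hasFDerivWithinAt_grad hG (hF j).1 hx).const_smul (a j))
  refine (h.congr_of_eventuallyEq ?_ (grad_perturb hf hF a hx.1)).fderivWithin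
    (uniqueDiffWithinAt_chart hx.1)
  filter_upwards [eventually_mem_target hx.1] with w hw
  have := grad_perturb (G := G) hf hF a ((extChartAt (𝓡∂ (2 * n)) q).map_target hw)
  rwa [(extChartAt (𝓡∂ (2 * n)) q).right_inv hw] at this

lemma grad_coord {q x : M} {G : M → Fin n → ℂ}
    (hG : ContMDiff (𝓡∂ (2 * n)) 𝓘(ℝ, Fin n → ℂ) ∞ G) (hx : x ∈ coordSet q G) (j : Fin n) :
    grad q G (fun x => G x j) (extChartAt (𝓡∂ (2 * n)) q x) = Pi.single j 1 := by
  ext i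
  rw [grad, chartDeriv_apply hG hx.1]
  obtain ⟨N, hN⟩ := isInvertible_of_injective hx.2
  rw [← hN, ContinuousLinearMap.inverse_equiv]
  simp [Pi.single_apply, eq_comm]

/-- The gradient of the coordinate `G_j` is the constant `e_j`, so perturbing by the coordinates
themselves is a translation of the gradient. -/
lemma grad_perturb_coord {q x : M} {f : M → ℂ} {G : M → Fin n → ℂ} (hf : f ∈ X.hol)
    (hG : ∀ j, (fun x => G x j) ∈ X.hol) (a : Fin n → ℂ) (hx : x ∈ coordSet q G) :
    grad q G (perturb f G a) (extChartAt (𝓡∂ (2 * n)) q x) =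
      grad q G f (extChartAt (𝓡∂ (2 * n)) q x) + a := by
  have hGs := ComplexStructure.contMDiff_of_forall_hol hG
  rw [grad_perturb hf hG a hx.1]
  simp only [grad_coord hGs hx]
  congr 1
  ext i
  simp [Finset.sum_apply, Pi.single_apply]

lemma fderivWithin_grad_perturb_coord {q x : M} {f : M → ℂ} {G : M → Fin n → ℂ} (hf : f ∈ X.hol)
    (hG : ∀ j, (fun x => G x j) ∈ X.hol) (a : Fin n → ℂ) (hx : x ∈ coordSet q G) :
    fderivWithin ℝ (grad q G (perturb f G a)) (range (𝓡∂ (2 * n)))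
        (extChartAt (𝓡∂ (2 * n)) q x) =
      fderivWithin ℝ (grad q G f) (range (𝓡∂ (2 * n))) (extChartAt (𝓡∂ (2 * n)) q x) := by
  have hGs := ComplexStructure.contMDiff_of_forall_hol hG
  refine (((hasFDerivWithinAt_grad hGs hf.1 hx).add_const a).congr_of_eventuallyEq ?_
    (grad_perturb_coord hf hG a hx)).fderivWithin (uniqueDiffWithinAt_chart hx.1)
  filter_upwards [eventually_mem_target hx.1,
    eventually_extChartAt_symm hx.1 (coordSet_mem_nhds hGs hx)] with w hw hw2
  have := grad_perturb_coord hf hG a hw2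
  rwa [(extChartAt (𝓡∂ (2 * n)) q).right_inv hw] at this

lemma tendsto_add_sum_smul {ι T V : Type*} [Fintype ι] [AddCommGroup V] [TopologicalSpace V]
    [ContinuousAdd V] [Module ℂ V] [ContinuousSMul ℂ V] {l : Filter T} {u : T → V} {A : V}
    {a : T → ι → ℂ} {w : ι → T → V} {B : ι → V} (hu : Tendsto u l (𝓝 A))
    (ha : ∀ j, Tendsto (fun t => a t j) l (𝓝 0)) (hw : ∀ j, Tendsto (w j) l (𝓝 (B j))) :
    Tendsto (fun t => u t + ∑ j, a t j • w j t) l (𝓝 A) := by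
  simpa using hu.add (tendsto_finsetSum Finset.univ fun j _ => (ha j).smul (hw j))

/-- Being Morse is stable under small perturbations and small displacements. -/
lemma eventually_morseAt_perturb (hcharts : X.HasGlobalHolomorphicCharts) {q : M} {f : M → ℂ}
    {F : M → Fin n → ℂ} (hf : f ∈ X.hol) (hF : ∀ j, (fun x => F x j) ∈ X.hol)
    (hq : MorseAt (n := n) f q) :
    ∀ᶠ ay : (Fin n → ℂ) × M in 𝓝 (0, q), MorseAt (n := n) (perturb f F ay.1) ay.2 := by
  obtain ⟨G, hG, -, hqG⟩ := hcharts.exists_coords q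
  have hGs := ComplexStructure.contMDiff_of_forall_hol hG
  rw [morseAt_iff hG hf hqG] at hq
  have hnear : ∀ᶠ ay : (Fin n → ℂ) × M in 𝓝 (0, q), ay.2 ∈ coordSet q G :=
    continuousAt_snd.eventually (coordSet_mem_nhds hGs hqG)
  have hφ : Tendsto (fun ay : (Fin n → ℂ) × M => extChartAt (𝓡∂ (2 * n)) q ay.2) (𝓝 (0, q))
      (𝓝[range (𝓡∂ (2 * n))] (extChartAt (𝓡∂ (2 * n)) q q)) :=
    (tendsto_extChartAt_nhdsWithin hqG.1).comp (continuousAt_snd (p := ((0 : Fin n → ℂ), q)))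
  have hfst : ∀ j, Tendsto (fun ay : (Fin n → ℂ) × M => ay.1 j) (𝓝 (0, q)) (𝓝 0) := fun j =>
    (((continuous_apply j).comp continuous_fst).tendsto ((0 : Fin n → ℂ), q))
  -- At a critical point, injectivity of the derivative of the gradient persists nearby; at any
  -- other point, nonvanishing of the gradient does.
  by_cases h0 : grad q G f (extChartAt (𝓡∂ (2 * n)) q q) = 0
  · have hc : ∀ u ∈ X.hol, Tendsto (fun ay : (Fin n → ℂ) × M =>
        fderivWithin ℝ (grad q G u) (range (𝓡∂ (2 * n))) (extChartAt (𝓡∂ (2 * n)) q ay.2))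
        (𝓝 (0, q)) (𝓝 (fderivWithin ℝ (grad q G u) (range (𝓡∂ (2 * n)))
          (extChartAt (𝓡∂ (2 * n)) q q))) := fun u hu =>
      ((contDiffWithinAt_grad hGs hu.1 hqG).fderivWithin_right (m := 0)
        (𝓡∂ (2 * n)).uniqueDiffOn (by simp)
        (extChartAt_mem_range hqG.1)).continuousWithinAt.tendsto.comp hφ
    have ht := tendsto_add_sum_smul (hc f hf) hfst fun j => hc _ (hF j)
    filter_upwards [hnear, ht.eventually (ContinuousLinearMap.isOpen_injective.mem_nhds (hq h0))]
      with ay h1 h2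
    rw [morseAt_iff hG (perturb_mem_hol hf hF _) h1, fderivWithin_grad_perturb hGs hf hF _ h1]
    exact fun _ => h2
  · have hc : ∀ u ∈ X.hol, Tendsto (fun ay : (Fin n → ℂ) × M =>
        grad q G u (extChartAt (𝓡∂ (2 * n)) q ay.2))
        (𝓝 (0, q)) (𝓝 (grad q G u (extChartAt (𝓡∂ (2 * n)) q q))) := fun u hu =>
      (contDiffWithinAt_grad hGs hu.1 hqG).continuousWithinAt.tendsto.comp hφ
    have ht := tendsto_add_sum_smul (hc f hf) hfst fun j => hc _ (hF j)
    filter_upwards [hnear, ht.eventually_ne h0] with ay h1 h2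
    rw [morseAt_iff hG (perturb_mem_hol hf hF _) h1, grad_perturb hf hF _ h1.1]
    exact fun h => absurd h h2

/-- Critical points of a Morse function are isolated. -/
lemma MorseAt.eventually_isCriticalPoint_imp_eq (hcharts : X.HasGlobalHolomorphicCharts) {q : M}
    {f : M → ℂ} (hf : f ∈ X.hol) (hq : MorseAt (n := n) f q) :
    ∀ᶠ y in 𝓝 q, IsCriticalPoint (n := n) (fun x => (f x).im) y → y = q := by
  obtain ⟨G, hG, -, hqG⟩ := hcharts.exists_coords q
  have hGs := ComplexStructure.contMDiff_of_forall_hol hG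
  rw [morseAt_iff hG hf hqG] at hq
  by_cases h0 : grad q G f (extChartAt (𝓡∂ (2 * n)) q q) = 0
  · obtain ⟨N, hN⟩ := isInvertible_of_injective (hq h0)
    -- An invertible derivative is bounded below, so the gradient has no other zero near `q`.
    have h1 := (hasFDerivWithinAt_grad hGs hf.1 hqG).eventually_ne (c := 0)
      ⟨_, by rw [← hN]; exact N.antilipschitz⟩
    rw [sdiff_eq, nhdsWithin_inter', eventually_inf_principal] at h1
    filter_upwards [coordSet_mem_nhds hGs hqG,
      (tendsto_extChartAt_nhdsWithin hqG.1).eventually h1] with y h2 h3 h4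
    rw [isCriticalPoint_iff_grad_eq_zero hG hf h2] at h4
    by_contra h5
    exact h3 (fun h6 => h5 ((extChartAt (𝓡∂ (2 * n)) q).injOn h2.1 hqG.1 h6)) h4
  · have ht := (contDiffWithinAt_grad hGs hf.1 hqG).continuousWithinAt.tendsto.comp
      (tendsto_extChartAt_nhdsWithin hqG.1)
    filter_upwards [coordSet_mem_nhds hGs hqG, ht.eventually_ne h0] with y h2 h3 h4
    rw [isCriticalPoint_iff_grad_eq_zero hG hf h2] at h4
    exact absurd h4 h3

/-- By Sard's theorem, generic perturbations by coordinates are Morse near a point. -/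
lemma dense_morseAt_perturb {q : M} {f : M → ℂ} {G : M → Fin n → ℂ} (hf : f ∈ X.hol)
    (hG : ∀ j, (fun x => G x j) ∈ X.hol) :
    Dense {a : Fin n → ℂ | ∀ y ∈ coordSet q G, MorseAt (n := n) (perturb f G a) y} := by
  have hGs := ComplexStructure.contMDiff_of_forall_hol hG
  -- This identification turns the gradient into a map of a space to itself, so that degeneracy
  -- becomes a vanishing determinant.
  let N : (Fin n → ℂ) ≃L[ℝ] EuclideanSpace ℝ (Fin (2 * n)) :=
    ContinuousLinearEquiv.ofFinrankEq (finrank_euclidean_eq n).symm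
  let D : EuclideanSpace ℝ (Fin (2 * n)) → EuclideanSpace ℝ (Fin (2 * n)) →L[ℝ] (Fin n → ℂ) :=
    fderivWithin ℝ (grad q G f) (range (𝓡∂ (2 * n)))
  let s : Set (EuclideanSpace ℝ (Fin (2 * n))) := {z | ∃ x ∈ coordSet q G,
    z = extChartAt (𝓡∂ (2 * n)) q x ∧ ¬ Function.Injective (D z)}
  have hnull : MeasureTheory.volume ((fun z => N (-grad q G f z)) '' s) = 0 := by
    refine MeasureTheory.addHaar_image_eq_zero_of_det_fderivWithin_eq_zero _
      (f' := fun z => (N : _ →L[ℝ] EuclideanSpace ℝ (Fin (2 * n))).comp (-D z)) ?_ ?_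
    · rintro z ⟨x, hx, rfl, -⟩
      refine (N.hasFDerivAt.comp_hasFDerivWithinAt _
        (hasFDerivWithinAt_grad hGs hf.1 hx).neg).mono ?_
      rintro w ⟨y, hy, rfl, -⟩
      exact extChartAt_mem_range hy.1
    · rintro z ⟨x, hx, rfl, h⟩
      by_contra hdet
      refine h fun v w hvw => ?_
      have hinj := (LinearMap.equivOfDetNeZero _ hdet).injective
      refine hinj ?_
      change N (-(D _ v)) = N (-(D _ w))
      rw [hvw]
  have hd := (MeasureTheory.Measure.dense_of_ae
    (MeasureTheory.measure_eq_zero_iff_ae_notMem.1 hnull))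
  have hd2 := hd.preimage N.toHomeomorph.isOpenMap
  refine hd2.mono fun a ha y hy => ?_
  rw [morseAt_iff hG (perturb_mem_hol hf hG a) hy, grad_perturb_coord hf hG a hy,
    fderivWithin_grad_perturb_coord hf hG a hy]
  intro h0
  by_contra hinj
  -- A degenerate critical point of the perturbed function would make `a` a critical value of the
  -- negative of the gradient of `f`.
  refine ha ⟨extChartAt (𝓡∂ (2 * n)) q y, ⟨y, hy, rfl, hinj⟩, ?_⟩
  change N (-grad q G f _) = N a
  rw [neg_eq_of_add_eq_zero_right h0]

end Perturbation

/-! ### Global construction -/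

section Existence

variable {n : ℕ} [NeZero n] {M : Type*} [TopologicalSpace M]
  [ChartedSpace (EuclideanHalfSpace (2 * n)) M] {X : ComplexStructure n M}

/-- Functions in `𝒪(M)` interpolate the values `1` at `p` and `0` on a finite set not
containing `p`. -/
lemma exists_hol_eq_one_eq_zero (hsep : X.HolomorphicallySeparable) (p : M) {s : Set M}
    (hs : s.Finite) : ∃ a ∈ X.hol, a p = 1 ∧ ∀ q ∈ s, q ≠ p → a q = 0 := by
  classical
  have h : ∀ q : M, ∃ a ∈ X.hol, a p = 1 ∧ (q ≠ p → a q = 0) := by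
    intro q
    by_cases hq : q = p
    · exact ⟨_, ComplexStructure.holC_const 1, rfl, fun h => absurd hq h⟩
    · obtain ⟨f, hf, hne⟩ := hsep q p hq
      refine ⟨fun x => (f x - f q) * (f p - f q)⁻¹, ComplexStructure.holC_mul
        (ComplexStructure.holC_sub_const hf _) (ComplexStructure.holC_const _),
        mul_inv_cancel₀ (sub_ne_zero.2 hne.symm), fun _ => by simp⟩
  choose a ha hap haq using h
  refine ⟨fun x => ∏ q ∈ hs.toFinset, a q x, ComplexStructure.holC_prod _ fun q _ => ha q,
    Finset.prod_eq_one fun q _ => hap q, fun q hq hqp =>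
    Finset.prod_eq_zero (hs.mem_toFinset.2 hq) (haq q hqp)⟩

variable [IsManifold (𝓡∂ (2 * n)) ∞ M]

lemma chartDeriv_mul {q x : M} {u v : M → ℂ} (hu : u ∈ X.hol) (hv : v ∈ X.hol)
    (hx : x ∈ (extChartAt (𝓡∂ (2 * n)) q).source) :
    chartDeriv q (fun x => u x * v x) (extChartAt (𝓡∂ (2 * n)) q x) =
      u x • chartDeriv q v (extChartAt (𝓡∂ (2 * n)) q x) +
        v x • chartDeriv q u (extChartAt (𝓡∂ (2 * n)) q x) := by
  have h := (hasFDerivWithinAt_chart hx (hu.1 x)).mul (hasFDerivWithinAt_chart hx (hv.1 x))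
  simp only [Function.comp_apply, (extChartAt (𝓡∂ (2 * n)) q).left_inv hx] at h
  exact chartDeriv_eq hx h

/-- The sum of the squares of coordinates centered at `p` has a nondegenerate critical point
at `p`. -/
lemma exists_morseAt_of_chartDeriv_eq_zero (hcharts : X.HasGlobalHolomorphicCharts) (p : M) :
    ∃ f ∈ X.hol, chartDeriv p f (extChartAt (𝓡∂ (2 * n)) p p) = 0 ∧ MorseAt (n := n) f p := by
  obtain ⟨G, hG, hGp, hp⟩ := hcharts.exists_coords p
  have hGs := ComplexStructure.contMDiff_of_forall_hol hG
  have hsq : ∀ j, (fun x => G x j * G x j) ∈ X.hol :=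
    fun j => ComplexStructure.holC_mul (hG j) (hG j)
  have hf : (fun x => ∑ j, G x j * G x j) ∈ X.hol := ComplexStructure.holC_sum _ fun j _ => hsq j
  have hd : ∀ x ∈ (extChartAt (𝓡∂ (2 * n)) p).source,
      chartDeriv p (fun x => ∑ j, G x j * G x j) (extChartAt (𝓡∂ (2 * n)) p x) =
        ∑ j, (2 * G x j) • chartDeriv p (fun x => G x j) (extChartAt (𝓡∂ (2 * n)) p x) := by
    intro x hx
    rw [chartDeriv_eq hx (f := fun x => ∑ j, G x j * G x j) (HasFDerivWithinAt.fun_sum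
      (u := Finset.univ) fun j _ => hasFDerivWithinAt_chart hx ((hsq j).1 x))]
    refine Finset.sum_congr rfl fun j _ => ?_
    rw [chartDeriv_mul (hG j) (hG j) hx, ← add_smul, ← two_mul (G x j)]
  -- The gradient of `∑ G_j²` is `2G`, whose real derivative is injective because that of `G` is.
  have hgrad : ∀ x ∈ coordSet p G, grad p G (fun x => ∑ j, G x j * G x j)
      (extChartAt (𝓡∂ (2 * n)) p x) = (2 : ℝ) • G x := by
    intro x hx
    ext i
    have h1 : ∀ j, chartDeriv p (fun x => G x j) (extChartAt (𝓡∂ (2 * n)) p x)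
        ((chartDeriv p G (extChartAt (𝓡∂ (2 * n)) p x)).inverse (Pi.single i 1)) =
        (Pi.single j 1 : Fin n → ℂ) i := fun j => congrFun (grad_coord hGs hx j) i
    rw [grad, hd x hx.1, _root_.sum_apply]
    simp only [_root_.smul_apply, h1]
    simp [Pi.single_apply]
  refine ⟨_, hf, ?_, ?_⟩
  · rw [hd p hp.1, hGp]
    refine Finset.sum_eq_zero fun j _ => ?_
    rw [Pi.zero_apply, mul_zero, zero_smul]
  · rw [morseAt_iff hG hf hp]
    intro _
    have h2 : HasFDerivWithinAt (grad p G (fun x => ∑ j, G x j * G x j))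
        ((2 : ℝ) • chartDeriv p G (extChartAt (𝓡∂ (2 * n)) p p)) (range (𝓡∂ (2 * n)))
        (extChartAt (𝓡∂ (2 * n)) p p) := by
      refine ((hasFDerivWithinAt_chart hp.1 (hGs p)).const_smul
        (2 : ℝ)).congr_of_eventuallyEq ?_ ?_
      · filter_upwards [eventually_mem_target hp.1,
          eventually_extChartAt_symm hp.1 (coordSet_mem_nhds hGs hp)] with w hw hw2
        have h3 := hgrad _ hw2
        rwa [(extChartAt (𝓡∂ (2 * n)) p).right_inv hw] at h3
      · rw [hgrad p hp, Pi.smul_apply, Function.comp_apply,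
          (extChartAt (𝓡∂ (2 * n)) p).left_inv hp.1]
    rw [h2.fderivWithin (uniqueDiffWithinAt_chart hp.1)]
    exact (smul_right_injective _ (two_ne_zero (α := ℝ))).comp hp.2

/-- Away from `p` there are local coordinates given by global functions that vanish to second order
at `p`. -/
lemma exists_coords_of_ne (hcharts : X.HasGlobalHolomorphicCharts)
    (hsep : X.HolomorphicallySeparable) {p q : M} (hqp : q ≠ p) :
    ∃ G : M → Fin n → ℂ, (∀ j, (fun x => G x j) ∈ X.hol) ∧ q ∈ coordSet q G ∧
      ∀ j, chartDeriv p (fun x => G x j) (extChartAt (𝓡∂ (2 * n)) p p) = 0 := by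
  obtain ⟨g, hg, hgq, hq⟩ := hcharts.exists_coords q
  have hgs := ComplexStructure.contMDiff_of_forall_hol hg
  obtain ⟨h₀, hh₀, hne⟩ := hsep q p hqp
  -- The coordinates are `h² g`. The double zero of `h²` kills the differential at `p`; at `q`,
  -- where `g` vanishes, the differential is `h(q)² dg` with `h(q) ≠ 0`.
  let h : M → ℂ := fun x => h₀ x - h₀ p
  have hh : h ∈ X.hol := ComplexStructure.holC_sub_const hh₀ _
  have hhp : h p = 0 := sub_self _
  have hhq : h q ≠ 0 := sub_ne_zero.2 hne
  have hhg : ∀ j, (fun x => h x * g x j) ∈ X.hol := fun j => ComplexStructure.holC_mul hh (hg j)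
  have hG : ∀ j, (fun x => h x * (h x * g x j)) ∈ X.hol :=
    fun j => ComplexStructure.holC_mul hh (hhg j)
  have hGs : ContMDiff (𝓡∂ (2 * n)) 𝓘(ℝ, Fin n → ℂ) ∞ (fun x j => h x * (h x * g x j)) :=
    ComplexStructure.contMDiff_of_forall_hol hG
  refine ⟨fun x j => h x * (h x * g x j), hG, ⟨mem_extChartAt_source q, ?_⟩, fun j => ?_⟩
  · have hv : ∀ v, chartDeriv q (fun x j => h x * (h x * g x j)) (extChartAt (𝓡∂ (2 * n)) q q) v =
        (h q * h q) • chartDeriv q g (extChartAt (𝓡∂ (2 * n)) q q) v := by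
      intro v
      ext j
      rw [← chartDeriv_apply hGs hq.1, chartDeriv_mul hh (hhg j) hq.1, chartDeriv_mul hh (hg j) hq.1,
        hgq, Pi.zero_apply, mul_zero, zero_smul, add_zero, add_zero, smul_smul,
        _root_.smul_apply, chartDeriv_apply hgs hq.1, Pi.smul_apply]
    intro v w hvw
    rw [hv, hv] at hvw
    exact hq.2 (smul_right_injective _ (mul_ne_zero hhq hhq) hvw)
  · rw [chartDeriv_mul hh (hhg j) (mem_extChartAt_source p), hhp, zero_mul, zero_smul, zero_smul,
      add_zero]

/-- Enlarging the set on which a function with prescribed critical point is Morse. -/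
lemma exists_nhds_extend_morse [T2Space M] [CompactSpace M]
    (hcharts : X.HasGlobalHolomorphicCharts) (hsep : X.HolomorphicallySeparable) {p q : M}
    (hqp : q ≠ p) :
    ∃ t ∈ 𝓝 q, IsCompact t ∧ ∀ K : Set M, IsCompact K → ∀ f ∈ X.hol,
      chartDeriv p f (extChartAt (𝓡∂ (2 * n)) p p) = 0 → (∀ y ∈ K, MorseAt (n := n) f y) →
      ∃ g ∈ X.hol, chartDeriv p g (extChartAt (𝓡∂ (2 * n)) p p) = 0 ∧
        ∀ y ∈ K ∪ t, MorseAt (n := n) g y := by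
  obtain ⟨G, hG, hq, hGp⟩ := exists_coords_of_ne hcharts hsep hqp
  have hGs := ComplexStructure.contMDiff_of_forall_hol hG
  obtain ⟨t, ht, htG, htc⟩ := local_compact_nhds (coordSet_mem_nhds hGs hq)
  -- The neighbourhood `t` is chosen before `K` and `f`, which lets a finite cover be fixed in
  -- advance of the perturbations.
  refine ⟨t, ht, htc, fun K hK f hf hfp hfK => ?_⟩
  have hev : ∀ᶠ a : Fin n → ℂ in 𝓝 0, ∀ y ∈ K, MorseAt (n := n) (perturb f G a) y :=
    hK.eventually_forall_of_forall_eventually fun y hy =>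
      eventually_morseAt_perturb hcharts hf hG (hfK y hy)
  obtain ⟨a, haK, hat⟩ := (dense_morseAt_perturb (q := q) hf hG).inter_nhds_nonempty hev
  refine ⟨perturb f G a, perturb_mem_hol hf hG a, ?_, ?_⟩
  · rw [chartDeriv_perturb hf hG a (mem_extChartAt_source p), hfp, zero_add]
    refine Finset.sum_eq_zero fun j _ => ?_
    rw [hGp, smul_zero]
  · rintro y (hy | hy)
    · exact hat y hy
    · exact haK y (htG hy)

/-- For every point `p` there is a function in `𝒪(M)` with a critical point at `p` and whose
imaginary part is Morse. -/
lemma exists_morse [T2Space M] [CompactSpace M] (hcharts : X.HasGlobalHolomorphicCharts)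
    (hsep : X.HolomorphicallySeparable) (p : M) :
    ∃ f ∈ X.hol, chartDeriv p f (extChartAt (𝓡∂ (2 * n)) p p) = 0 ∧
      ∀ y, MorseAt (n := n) f y := by
  obtain ⟨f₀, hf₀, hf₀p, hM₀⟩ := exists_morseAt_of_chartDeriv_eq_zero hcharts p
  have hnear : ∀ᶠ y in 𝓝 p, MorseAt (n := n) f₀ y := by
    -- Stability with zero perturbing functions says that being Morse is an open condition on the
    -- point.
    have h0 : ∀ j : Fin n, (fun x => (fun (_ : M) (_ : Fin n) => (0 : ℂ)) x j) ∈ X.hol :=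
      fun _ => ComplexStructure.holC_const 0
    have h1 := ((Continuous.prodMk_right (0 : Fin n → ℂ)).tendsto p).eventually
      (eventually_morseAt_perturb hcharts hf₀ h0 hM₀)
    simpa only [perturb_zero] using h1
  obtain ⟨W, hW, hWM, hWc⟩ := local_compact_nhds hnear
  have hcompl : IsCompact (interior W)ᶜ := isOpen_interior.isClosed_compl.isCompact
  -- The statement quantifies over all starting pairs `K₀`, `f` so that the extension steps for two
  -- sets compose under unions.
  have key : ∃ K : Set M, (interior W)ᶜ ⊆ K ∧ ∀ K₀ : Set M, IsCompact K₀ → ∀ f ∈ X.hol,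
      chartDeriv p f (extChartAt (𝓡∂ (2 * n)) p p) = 0 → (∀ y ∈ K₀, MorseAt (n := n) f y) →
      IsCompact K ∧ ∃ g ∈ X.hol, chartDeriv p g (extChartAt (𝓡∂ (2 * n)) p p) = 0 ∧
        ∀ y ∈ K₀ ∪ K, MorseAt (n := n) g y := by
    refine hcompl.induction_on (p := fun s => ∃ K : Set M, s ⊆ K ∧ ∀ K₀ : Set M, IsCompact K₀ →
      ∀ f ∈ X.hol, chartDeriv p f (extChartAt (𝓡∂ (2 * n)) p p) = 0 →
      (∀ y ∈ K₀, MorseAt (n := n) f y) → IsCompact K ∧ ∃ g ∈ X.hol,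
      chartDeriv p g (extChartAt (𝓡∂ (2 * n)) p p) = 0 ∧ ∀ y ∈ K₀ ∪ K, MorseAt (n := n) g y)
      ?_ ?_ ?_ ?_
    · exact ⟨∅, Subset.rfl, fun K₀ _ f hf hfp hfK =>
        ⟨isCompact_empty, f, hf, hfp, by simpa using hfK⟩⟩
    · rintro s t hst ⟨K, hK, h⟩
      exact ⟨K, hst.trans hK, h⟩
    · rintro s t ⟨K, hK, h⟩ ⟨L, hL, h'⟩
      refine ⟨K ∪ L, union_subset_union hK hL, fun K₀ hK₀ f hf hfp hfK => ?_⟩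
      obtain ⟨hKc, g, hg, hgp, hgK⟩ := h K₀ hK₀ f hf hfp hfK
      obtain ⟨hLc, g', hg', hgp', hgL⟩ := h' _ (hK₀.union hKc) g hg hgp hgK
      exact ⟨hKc.union hLc, g', hg', hgp', by rwa [← union_assoc]⟩
    · intro q hq
      have hqp : q ≠ p := fun h => hq (h ▸ mem_interior_iff_mem_nhds.2 hW)
      obtain ⟨t, ht, htc, h⟩ := exists_nhds_extend_morse hcharts hsep hqp
      exact ⟨t, mem_nhdsWithin_of_mem_nhds ht, t, Subset.rfl, fun K₀ hK₀ f hf hfp hfK =>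
        ⟨htc, h K₀ hK₀ f hf hfp hfK⟩⟩
  obtain ⟨K, hK, h⟩ := key
  obtain ⟨-, g, hg, hgp, hgM⟩ := h W hWc f₀ hf₀ hf₀p hWM
  refine ⟨g, hg, hgp, fun y => hgM y ?_⟩
  by_cases hy : y ∈ W
  · exact Or.inl hy
  · exact Or.inr (hK fun h => hy (interior_subset h))

/-- A Morse function on a compact manifold has finitely many critical points. -/
lemma finite_isCriticalPoint [CompactSpace M] (hcharts : X.HasGlobalHolomorphicCharts)
    {f : M → ℂ} (hf : f ∈ X.hol) (hM : ∀ y, MorseAt (n := n) f y) :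
    {q : M | IsCriticalPoint (n := n) (fun x => (f x).im) q}.Finite := by
  have h := (isCompact_univ (X := M)).induction_on
    (p := fun s => (s ∩ {q : M | IsCriticalPoint (n := n) (fun x => (f x).im) q}).Finite)
    (by simp) (fun s t hst ht => ht.subset (inter_subset_inter_left _ hst))
    (fun s t hs ht => by rw [union_inter_distrib_right]; exact hs.union ht) (fun q _ => by
      refine ⟨_, mem_nhdsWithin_of_mem_nhds
        ((hM q).eventually_isCriticalPoint_imp_eq hcharts hf), ?_⟩
      exact (finite_singleton q).subset fun y hy => hy.1 hy.2)
  simpa using h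

end Existence

end ComplexBdry

end

theorem mainTheorem2 {n : ℕ} [NeZero n] {M : Type*} [TopologicalSpace M] [T2Space M]
    [CompactSpace M] [ChartedSpace (EuclideanHalfSpace (2 * n)) M]
    [IsManifold (𝓡∂ (2 * n)) ∞ M] (X : ComplexBdry.ComplexStructure n M)
    (hcharts : X.HasGlobalHolomorphicCharts) (hsep : X.HolomorphicallySeparable)
    (k : ℕ) (hk : 2 ≤ k) :
    ∃ S : Set M, Dense S ∧ ∀ p ∈ S, ∃ Φ a : M → ℂ,
      Φ ∈ X.holC k ∧
      mfderiv (𝓡∂ (2 * n)) 𝓘(ℝ, ℂ) Φ p = 0 ∧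
      ComplexBdry.IsMorse (n := n) (fun x => (Φ x).im) ∧
      {q : M | ComplexBdry.IsCriticalPoint (n := n) (fun x => (Φ x).im) q}.Finite ∧
      a ∈ X.hol ∧
      a p = 1 ∧
      (∀ q : M, ComplexBdry.IsCriticalPoint (n := n) (fun x => (Φ x).im) q → q ≠ p → a q = 0) ∧
      ∀ h : ℝ, 0 < h →
        (fun x => Complex.exp (Φ x / h) * a x) ∈ X.holC k ∧
        (fun x => Complex.exp (-Φ x / h) * a x) ∈ X.holC k := by
  -- No genericity of `p` is needed: the dense set is all of `M`.
  refine ⟨Set.univ, dense_univ, fun p _ => ?_⟩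
  obtain ⟨Φ, hΦ, hΦp, hM⟩ := ComplexBdry.exists_morse hcharts hsep p
  have hfin := ComplexBdry.finite_isCriticalPoint hcharts hΦ hM
  obtain ⟨a, ha, hap, haq⟩ := ComplexBdry.exists_hol_eq_one_eq_zero hsep p hfin
  have hexp : ∀ c : ℂ, (fun x => Complex.exp (Φ x * c) * a x) ∈ X.holC k := fun c =>
    ComplexBdry.ComplexStructure.hol_subset_holC k (ComplexBdry.ComplexStructure.holC_mul
      (ComplexBdry.ComplexStructure.holC_exp (ComplexBdry.ComplexStructure.holC_mul hΦ
        (ComplexBdry.ComplexStructure.holC_const c))) ha)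
  refine ⟨Φ, a, ComplexBdry.ComplexStructure.hol_subset_holC k hΦ, ?_,
    ⟨ComplexBdry.contMDiff_im ((ComplexBdry.ComplexStructure.hol_subset_holC k hΦ).1.of_le
      (by exact_mod_cast hk)), hM⟩, hfin, ha, hap,
    fun q hq hqp => haq q hq hqp, fun h _ => ⟨?_, ?_⟩⟩
  · rw [ComplexBdry.mfderiv_eq_chartDeriv (hΦ.1 p)]
    exact hΦp
  · simpa [div_eq_mul_inv] using hexp (h : ℂ)⁻¹
  · simpa [div_eq_mul_inv] using hexp (-(h : ℂ)⁻¹)
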